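/- Let $k\ge 1$ and let $\Delta=(\mathbf p_0,\dots,\mathbf p_k)$ be a non-degenerate $k$-simplex in $\mathbb R^k$, i.e. $k+1$ affinely independent points. For $n\ge 1$ let $C_n(\mathbb R^k)$ be the space of $n$-tuples of distinct points of $\mathbb R^k$, and let $C_n[\mathbb R^k]$ be the closure of its image in $(\mathbb R^k)^n\times (S^{k-1})^{n(n-1)}\times[0,\infty]^{n(n-1)(n-2)}$ under the map $\mathbf q\mapsto(\mathbf q,(\pi_{ij}(\mathbf q)),(r_{ijl}(\mathbf q)))$, where $\pi_{ij}(\mathbf q)=\frac{\mathbf q_i-\mathbf q_j}{\|\mathbf q_i-\mathbf q_j\|}$ and $r_{ijl}(\mathbf q)=\frac{\|\mathbf q_i-\mathbf q_j\|}{\|\mathbf q_i-\mathbf q_l\|}$ for pairwise distinct indices; identify $C_n(\mathbb R^k)$ with its image and put $\partial C_n[\mathbb R^k]=C_n[\mathbb R^k]\setminus C_n(\mathbb R^k)$. For a set $S$ of at least two labels, the $S$-face of $\partial C_n[\mathbb R^k]$ is the closure of the set of those points of $\partial C_n[\mathbb R^k]$ for which exactly the points labelled by $S$ coincide and all ratios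 $r_{ijl}$ with $i,j,l\in S$ lie in $(0,\infty)$; its interior consists of the points of the $S$-face that lie on no other such face. Let $\mathrm{Sim}(\Delta)\subset C_{k+1}(\mathbb R^k)$ be the set of configurations $\mathbf q$ similar to $\Delta$, i.e. with $r_{ijl}(\mathbf q)=r_{ijl}(\Delta)$ for all pairwise distinct $i,j,l$, and let $\partial\,\mathrm{Sim}(\Delta)=\overline{\mathrm{Sim}(\Delta)}\setminus \mathrm{Sim}(\Delta)$, the closure being taken in $C_{k+1}[\mathbb R^k]$. Then $\partial\,\mathrm{Sim}(\Delta)$ is contained in the interior of the $(0,\dots,k)$-face of $\partial C_{k+1}[\mathbb R^k]$ (the face where all points collide), and $\partial\,\mathrm{Sim}(\Delta)$ is diffeomorphic to $\operatorname{O}(k)\times\{0\}\times\mathbb R^k$. Here smoothness is that of maps between subsets of Euclidean spaces (local extendability to $C^\infty$ maps on open sets), with $S^{k-1}\subset\mathbb R^k$ and $[0,\infty]\cong[0,1]$ via $r\mapsto r/(1+r)$. -/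

import Mathlib

open scoped ENNReal ContDiff Matrix.Norms.Elementwise

noncomputable section

/-! ### The compactified configuration space `C_n[ℝ^k]` -/

/-- Euclidean space `ℝ^k`. -/
abbrev EucSpace (k : ℕ) : Type := EuclideanSpace ℝ (Fin k)

/-- The unit sphere `S^{k-1}` in `ℝ^k`. -/
abbrev UnitSphere (k : ℕ) : Type := Metric.sphere (0 : EucSpace k) 1

/-- Ordered pairs of distinct indices. -/
abbrev DistinctPair (n : ℕ) : Type := {p : Fin n × Fin n // p.1 ≠ p.2}

/-- Ordered triples of pairwise distinct indices. -/
abbrev DistinctTriple (n : ℕ) : Type :=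
  {t : Fin n × Fin n × Fin n // t.1 ≠ t.2.1 ∧ t.2.1 ≠ t.2.2 ∧ t.1 ≠ t.2.2}

/-- The open configuration space `C_n(ℝ^k)` of `n` distinct labelled points. -/
abbrev OpenConfig (n k : ℕ) : Type := {q : Fin n → EucSpace k // Function.Injective q}

/-- `A_n[ℝ^k] = (ℝ^k)^n × (S^{k-1})^{n(n-1)} × [0,∞]^{n(n-1)(n-2)}`. -/
abbrev ConfigAmbient (n k : ℕ) : Type :=
  (Fin n → EucSpace k) × (DistinctPair n → UnitSphere k) × (DistinctTriple n → ℝ≥0∞)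

/-- `π_{ij}(q) = (q_i - q_j) / ‖q_i - q_j‖`. -/
def direction {n k : ℕ} (q : OpenConfig n k) (p : DistinctPair n) : UnitSphere k :=
  ⟨‖q.1 p.1.1 - q.1 p.1.2‖⁻¹ • (q.1 p.1.1 - q.1 p.1.2), by
    have h : ‖q.1 p.1.1 - q.1 p.1.2‖ ≠ 0 :=
      norm_ne_zero_iff.mpr (sub_ne_zero.mpr fun e => p.2 (q.2 e))
    rw [mem_sphere_zero_iff_norm, norm_smul, norm_inv, norm_norm, inv_mul_cancel₀ h]⟩

/-- `r_{ijl}(q) = ‖q_i - q_j‖ / ‖q_i - q_l‖`, as an element of `[0,∞]`. -/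
def distRatio {n k : ℕ} (q : OpenConfig n k) (t : DistinctTriple n) : ℝ≥0∞ :=
  ENNReal.ofReal (‖q.1 t.1.1 - q.1 t.1.2.1‖ / ‖q.1 t.1.1 - q.1 t.1.2.2‖)

/-- The map `α_n = ι × (π_{ij}) × (r_{ijl}) : C_n(ℝ^k) → A_n[ℝ^k]`. -/
def configEmbed {n k : ℕ} (q : OpenConfig n k) : ConfigAmbient n k :=
  (q.1, direction q, distRatio q)

/-- The compactified configuration space `C_n[ℝ^k]`: the closure of the image of `α_n`. -/
def compactConfig (n k : ℕ) : Set (ConfigAmbient n k) :=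
  closure (Set.range (configEmbed (n := n) (k := k)))

/-- `∂C_n[ℝ^k] = C_n[ℝ^k] \ C_n(ℝ^k)`. -/
def compactConfigBoundary (n k : ℕ) : Set (ConfigAmbient n k) :=
  compactConfig n k \ Set.range (configEmbed (n := n) (k := k))

/-! ### The faces of `∂C_n[ℝ^k]` -/

/-- The open stratum of `∂C_n[ℝ^k]` in which exactly the points labelled by `S` have collided, all
of them at comparable rates (no limiting ratio of distances inside `S` is `0` or `∞`). -/
def collisionStratum {n : ℕ} (k : ℕ) (S : Finset (Fin n)) : Set (ConfigAmbient n k) :=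
  {x | x ∈ compactConfigBoundary n k ∧
    (∀ i j : Fin n, x.1 i = x.1 j ↔ (i = j ∨ (i ∈ S ∧ j ∈ S))) ∧
    ∀ t : DistinctTriple n, t.1.1 ∈ S → t.1.2.1 ∈ S → t.1.2.2 ∈ S →
      x.2.2 t ≠ 0 ∧ x.2.2 t ≠ ⊤}

/-- The closed face of `∂C_n[ℝ^k]` in which the points labelled by `S` collide. For `2 ≤ #S` these
are the codimension-one faces of the manifold with corners `C_n[ℝ^k]`. -/
def collisionFace {n : ℕ} (k : ℕ) (S : Finset (Fin n)) : Set (ConfigAmbient n k) :=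
  closure (collisionStratum k S)

/-- The interior of the face of `S`: the points of that face which lie on no other
codimension-one face. -/
def collisionFaceInterior {n : ℕ} (k : ℕ) (S : Finset (Fin n)) : Set (ConfigAmbient n k) :=
  {x | x ∈ collisionFace k S ∧
    ∀ T : Finset (Fin n), 2 ≤ T.card → T ≠ S → x ∉ collisionFace k T}

/-! ### Simplices similar to a given one -/

/-- The vertices of a non-degenerate simplex as a point of `C_{k+1}(ℝ^k)`. -/
def simplexConfig {k : ℕ} (Δ : Affine.Simplex ℝ (EucSpace k) k) : OpenConfig (k + 1) k :=
  ⟨Δ.points, Δ.independent.injective⟩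

/-- `Sim(Δ) ⊆ C_{k+1}(ℝ^k)`. -/
def Sim {k : ℕ} (Δ : Affine.Simplex ℝ (EucSpace k) k) : Set (OpenConfig (k + 1) k) :=
  {q | ∀ t : DistinctTriple (k + 1), distRatio q t = distRatio (simplexConfig Δ) t}

/-- The closure of `Sim(Δ)` in `C_{k+1}[ℝ^k]` (which is closed in `A_{k+1}[ℝ^k]`). -/
def simClosure {k : ℕ} (Δ : Affine.Simplex ℝ (EucSpace k) k) : Set (ConfigAmbient (k + 1) k) :=
  closure (configEmbed '' Sim Δ)

/-- The boundary of the closure of `Sim(Δ)`: what the closure adds to `Sim(Δ)`. -/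
def simBoundary {k : ℕ} (Δ : Affine.Simplex ℝ (EucSpace k) k) : Set (ConfigAmbient (k + 1) k) :=
  simClosure Δ \ configEmbed '' Sim Δ

/-! ### Smooth maps between subsets of Euclidean spaces -/

section Smooth

variable {E F : Type*} [NormedAddCommGroup E] [NormedSpace ℝ E]
  [NormedAddCommGroup F] [NormedSpace ℝ F]

/-- `f` is smooth on the arbitrary subset `X`: near each point of `X` it agrees on `X` with a
`C^∞` map defined on an open subset of the ambient space. -/
def SmoothOnSubset (f : E → F) (X : Set E) : Prop :=
  ∀ x ∈ X, ∃ U : Set E, IsOpen U ∧ x ∈ U ∧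
    ∃ g : E → F, ContDiffOn ℝ ∞ g U ∧ Set.EqOn f g (X ∩ U)

/-- `X` and `Y` are diffeomorphic: there are mutually inverse smooth maps between them. -/
def AreDiffeomorphic (X : Set E) (Y : Set F) : Prop :=
  ∃ (f : E → F) (g : F → E), SmoothOnSubset f X ∧ SmoothOnSubset g Y ∧
    Set.MapsTo f X Y ∧ Set.MapsTo g Y X ∧ Set.InvOn g f X Y

end Smooth

/-- The smooth coordinate `r ↦ r / (1 + r) = 1 - 1 / (1 + r)`, identifying `[0,∞]` with `[0,1]`
(`∞ ↦ 1`). -/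
def ratioCoord (r : ℝ≥0∞) : ℝ := 1 - ((1 + r)⁻¹).toReal

/-- The smooth embedding of `A_n[ℝ^k]` into the vector space
`(ℝ^k)^n × (ℝ^k)^{n(n-1)} × ℝ^{n(n-1)(n-2)}` given by `S^{k-1} ⊆ ℝ^k` and `[0,∞] ≅ [0,1] ⊆ ℝ`.
It defines the smooth structure on subsets of `A_n[ℝ^k]`. -/
def ambientCoord {n k : ℕ} (x : ConfigAmbient n k) :
    (Fin n → EucSpace k) × (DistinctPair n → EucSpace k) × (DistinctTriple n → ℝ) :=
  (x.1, fun p => (x.2.1 p : EucSpace k), fun t => ratioCoord (x.2.2 t))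

/-- `O(k) × {0} × ℝ^k`, as a subset of the vector space `ℝ^{k×k} × ℝ × ℝ^k`. -/
def orthogonalZeroTranslation (k : ℕ) : Set (Matrix (Fin k) (Fin k) ℝ × ℝ × EucSpace k) :=
  (Matrix.orthogonalGroup (Fin k) ℝ : Set (Matrix (Fin k) (Fin k) ℝ)) ×ˢ
    (({0} : Set ℝ) ×ˢ (Set.univ : Set (EucSpace k)))

end

/-!
A configuration with the same distance ratios as `P` is similar to `P`, and if `P` affinely spans
`ℝ^k` it is `b + s • A (P i - P o)` for an orthogonal `A`, a scale `0 < s` and the image `b` of a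
base vertex. Its directions are the images under `A` of those of `P` and its ratios are those of
`P`, so the formula extends to a map of all `(A, s, b)` into the compactification that no longer
sees the size of the configuration in its directions and ratios. Conversely `A`, `s` and `b` are
recovered smoothly: the directions of `P` span, so they determine `A` linearly, and pairing a
difference of two points with their direction gives `s`. Having such a left inverse, the map is
proper, hence closed, and the boundary of the set of similar configurations is the image of `s = 0`.
There all points coincide while the ratios stay positive and finite; this excludes every other face,
on which some ratio vanishes.
-/

section Isometry

variable {ι 𝕜 : Type*} [RCLike 𝕜]

theorem exists_linearIsometry_of_inner_eq {E F : Type*} [NormedAddCommGroup E]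
    [InnerProductSpace 𝕜 E] [NormedAddCommGroup F] [InnerProductSpace 𝕜 F] {v : ι → E} {w : ι → F}
    (hv : Submodule.span 𝕜 (Set.range v) = ⊤)
    (hvw : ∀ i j, inner 𝕜 (w i) (w j) = inner 𝕜 (v i) (v j)) :
    ∃ f : E →ₗᵢ[𝕜] F, ∀ i, f (v i) = w i := by
  have norm_eq (c : ι →₀ 𝕜) :
      ‖Finsupp.linearCombination 𝕜 w c‖ = ‖Finsupp.linearCombination 𝕜 v c‖ := by
    rw [@norm_eq_sqrt_re_inner 𝕜 F, @norm_eq_sqrt_re_inner 𝕜 E]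
    simp only [Finsupp.linearCombination_apply, Finsupp.sum_inner, Finsupp.inner_sum,
      inner_smul_left, inner_smul_right, hvw]
  -- By `norm_eq`, `v i ↦ w i` respects linear relations, so it does not matter which section `g` of
  -- the linear combinations of `v` defines the map.
  obtain ⟨g, hg⟩ := (Finsupp.linearCombination 𝕜 v).exists_rightInverse_of_surjective
    (by rw [Finsupp.range_linearCombination, hv])
  have hg_apply : ∀ x, Finsupp.linearCombination 𝕜 v (g x) = x := LinearMap.congr_fun hg
  refine ⟨⟨Finsupp.linearCombination 𝕜 w ∘ₗ g, fun x => ?_⟩, fun i => ?_⟩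
  · rw [LinearMap.comp_apply, norm_eq, hg_apply]
  · have h := norm_eq (g (v i) - Finsupp.single i 1)
    rw [map_sub, map_sub, hg_apply, Finsupp.linearCombination_single,
      Finsupp.linearCombination_single, one_smul, one_smul, sub_self, norm_zero,
      norm_sub_eq_zero_iff] at h
    exact h

variable {E F : Type*} [NormedAddCommGroup E] [InnerProductSpace ℝ E]
  [NormedAddCommGroup F] [InnerProductSpace ℝ F]

theorem exists_linearIsometry_of_congruent {v : ι → E} {w : ι → F} (h : Congruent w v)
    (hv : affineSpan ℝ (Set.range v) = ⊤) (o : ι) :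
    ∃ f : E →ₗᵢ[ℝ] F, ∀ i, w i - w o = f (v i - v o) := by
  have hspan : Submodule.span ℝ (Set.range fun i => v i - v o) = ⊤ := by
    rw [← AffineSubspace.vectorSpan_eq_top_of_affineSpan_eq_top ℝ E E hv,
      vectorSpan_range_eq_span_range_vsub_right ℝ v o]
    rfl
  obtain ⟨f, hf⟩ := exists_linearIsometry_of_inner_eq (w := fun i => w i - w o) hspan
    fun i j => by
      simp only [real_inner_eq_norm_mul_self_add_norm_mul_self_sub_norm_sub_mul_self_div_two,
        sub_sub_sub_cancel_right, ← dist_eq_norm, h.dist_eq]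
  exact ⟨f, fun i => (hf i).symm⟩

theorem exists_linearIsometry_of_similar {v : ι → E} {w : ι → F} (h : Similar w v)
    (hv : affineSpan ℝ (Set.range v) = ⊤) (o : ι) :
    ∃ s : ℝ, 0 < s ∧ ∃ f : E →ₗᵢ[ℝ] F, ∀ i, w i - w o = s • f (v i - v o) := by
  obtain ⟨s, hs, hdist⟩ := similar_iff_exists_pos_dist_eq.1 h
  have hcongr : Congruent (fun i => s⁻¹ • w i) v := congruent_iff_dist_eq.2 fun i j => by
    rw [dist_smul₀, hdist, norm_inv, Real.norm_of_nonneg hs.le, inv_mul_cancel_left₀ hs.ne']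
  obtain ⟨f, hf⟩ := exists_linearIsometry_of_congruent hcongr hv o
  refine ⟨s, hs, f, fun i => ?_⟩
  rw [← hf, ← smul_sub, smul_inv_smul₀ hs.ne']

end Isometry

section UnitaryMatrix

open Matrix (toEuclideanCLM unitaryGroup)

variable {𝕜 ι m : Type*} [RCLike 𝕜] [Fintype m] [DecidableEq m]

theorem mem_unitaryGroup_iff_norm_toEuclideanCLM {A : Matrix m m 𝕜} :
    A ∈ unitaryGroup m 𝕜 ↔ ∀ x, ‖toEuclideanCLM (𝕜 := 𝕜) A x‖ = ‖x‖ := by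
  rw [ContinuousLinearMap.norm_map_iff_adjoint_comp_self, Matrix.mem_unitaryGroup_iff',
    ← (EquivLike.injective (toEuclideanCLM (n := m) (𝕜 := 𝕜))).eq_iff, map_mul, map_one, map_star]
  rfl

theorem exists_mem_unitaryGroup_toEuclideanCLM_eq
    (f : EuclideanSpace 𝕜 m →ₗᵢ[𝕜] EuclideanSpace 𝕜 m) :
    ∃ A ∈ unitaryGroup m 𝕜, toEuclideanCLM (𝕜 := 𝕜) A = f.toContinuousLinearMap := by
  obtain ⟨A, hA⟩ := EquivLike.surjective (toEuclideanCLM (n := m) (𝕜 := 𝕜)) f.toContinuousLinearMap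
  refine ⟨A, mem_unitaryGroup_iff_norm_toEuclideanCLM.2 fun x => ?_, hA⟩
  rw [hA, LinearIsometry.coe_toContinuousLinearMap, f.norm_map]

theorem contDiff_toEuclideanCLM {r : WithTop ℕ∞} :
    ContDiff 𝕜 r (toEuclideanCLM (n := m) (𝕜 := 𝕜)) :=
  (toEuclideanCLM (n := m) (𝕜 := 𝕜)).toAlgEquiv.toLinearMap.toContinuousLinearMap.contDiff

theorem exists_leftInverse_toEuclideanCLM_apply [Finite ι] {v : ι → EuclideanSpace 𝕜 m}
    (hv : Submodule.span 𝕜 (Set.range v) = ⊤) :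
    ∃ R : (ι → EuclideanSpace 𝕜 m) →L[𝕜] Matrix m m 𝕜,
      ∀ A, R (fun i => toEuclideanCLM (𝕜 := 𝕜) A (v i)) = A := by
  let evalOn : Matrix m m 𝕜 →ₗ[𝕜] ι → EuclideanSpace 𝕜 m :=
    LinearMap.pi fun i => LinearMap.applyₗ (v i) ∘ₗ Matrix.toEuclideanLin.toLinearMap
  have hinj : Function.Injective evalOn := fun A B hAB =>
    Matrix.toEuclideanLin.injective (LinearMap.ext_on_range hv fun i => congrFun hAB i)
  obtain ⟨R, hR⟩ := evalOn.exists_leftInverse_of_injective (LinearMap.ker_eq_bot.2 hinj)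
  exact ⟨R.toContinuousLinearMap, LinearMap.congr_fun hR⟩

end UnitaryMatrix

section Smooth

variable {E F : Type*} [NormedAddCommGroup E] [NormedSpace ℝ E]
  [NormedAddCommGroup F] [NormedSpace ℝ F]

theorem smoothOnSubset_of_contDiff {f : E → F} (hf : ContDiff ℝ ∞ f) (X : Set E) :
    SmoothOnSubset f X :=
  fun x _ => ⟨Set.univ, isOpen_univ, Set.mem_univ x, f, hf.contDiffOn, fun _ _ => rfl⟩

theorem areDiffeomorphic_image {f : E → F} {g : F → E} (hf : ContDiff ℝ ∞ f)
    (hg : ContDiff ℝ ∞ g) {X : Set E} (hgf : Set.LeftInvOn g f X) :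
    AreDiffeomorphic (f '' X) X :=
  ⟨g, f, smoothOnSubset_of_contDiff hg _, smoothOnSubset_of_contDiff hf X,
    hgf.mapsTo (Set.surjOn_image f X), Set.mapsTo_image f X, hgf.rightInvOn_image, hgf⟩

end Smooth

theorem continuous_ratioCoord : Continuous ratioCoord := by
  refine continuous_const.sub
    (ENNReal.continuousOn_toReal.comp_continuous (by fun_prop) fun r => ?_)
  simp

theorem continuous_ambientCoord {n k : ℕ} : Continuous (ambientCoord (n := n) (k := k)) := by
  have := continuous_ratioCoord
  unfold ambientCoord
  fun_prop

section Configurations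

variable {n k : ℕ}

theorem dist_pos_of_ne (q : OpenConfig n k) {i j : Fin n} (hij : i ≠ j) :
    0 < dist (q.1 i) (q.1 j) :=
  dist_pos.2 (q.2.ne hij)

theorem coe_direction (q : OpenConfig n k) (p : DistinctPair n) :
    (direction q p : EucSpace k)
      = (dist (q.1 p.1.1) (q.1 p.1.2))⁻¹ • (q.1 p.1.1 - q.1 p.1.2) := by
  rw [dist_eq_norm]
  rfl

theorem dist_smul_direction (q : OpenConfig n k) (p : DistinctPair n) :
    dist (q.1 p.1.1) (q.1 p.1.2) • (direction q p : EucSpace k) = q.1 p.1.1 - q.1 p.1.2 := by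
  rw [coe_direction, smul_inv_smul₀ (dist_pos_of_ne q p.2).ne']

theorem coe_direction_eq_of_sub_eq_smul {q : OpenConfig n k} {p : DistinctPair n} {c : ℝ}
    {u : EucSpace k} (hc : 0 < c) (hu : ‖u‖ = 1) (h : q.1 p.1.1 - q.1 p.1.2 = c • u) :
    (direction q p : EucSpace k) = u := by
  rw [coe_direction, dist_eq_norm, h, norm_smul, hu, Real.norm_of_nonneg hc.le, mul_one,
    inv_smul_smul₀ hc.ne']

theorem span_range_direction {q : OpenConfig n k} (hq : affineSpan ℝ (Set.range q.1) = ⊤) :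
    Submodule.span ℝ (Set.range fun p => (direction q p : EucSpace k)) = ⊤ := by
  rw [eq_top_iff, ← AffineSubspace.vectorSpan_eq_top_of_affineSpan_eq_top ℝ _ _ hq,
    vectorSpan_def, Submodule.span_le]
  rintro _ ⟨_, ⟨i, rfl⟩, _, ⟨j, rfl⟩, rfl⟩
  rcases eq_or_ne i j with rfl | hij
  · simp
  · change q.1 i - q.1 j ∈ _
    rw [← dist_smul_direction q ⟨(i, j), hij⟩]
    exact Submodule.smul_mem _ _ (Submodule.subset_span ⟨_, rfl⟩)

theorem distRatio_apply (q : OpenConfig n k) (t : DistinctTriple n) :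
    distRatio q t
      = ENNReal.ofReal (dist (q.1 t.1.1) (q.1 t.1.2.1) / dist (q.1 t.1.1) (q.1 t.1.2.2)) := by
  simp only [distRatio, dist_eq_norm]

theorem distRatio_ne_zero (q : OpenConfig n k) (t : DistinctTriple n) : distRatio q t ≠ 0 := by
  rw [distRatio_apply, Ne, ENNReal.ofReal_eq_zero, not_le]
  exact div_pos (dist_pos_of_ne q t.2.1) (dist_pos_of_ne q t.2.2.2)

theorem distRatio_ne_top (q : OpenConfig n k) (t : DistinctTriple n) : distRatio q t ≠ ⊤ :=
  ENNReal.ofReal_ne_top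

theorem distRatio_eq_of_similar {q P : OpenConfig n k} (h : Similar q.1 P.1) :
    distRatio q = distRatio P := by
  obtain ⟨s, hs, hdist⟩ := similar_iff_exists_pos_dist_eq.1 h
  funext t
  rw [distRatio_apply, distRatio_apply, hdist, hdist, mul_div_mul_left _ _ hs.ne']

theorem similar_of_distRatio_eq {q P : OpenConfig n k} (h : distRatio q = distRatio P) :
    Similar q.1 P.1 := by
  rcases subsingleton_or_nontrivial (Fin n) with _ | _
  · exact Similar.of_subsingleton_index
  obtain ⟨i₀, j₀, h₀⟩ := exists_pair_ne (Fin n)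
  let scale (i j : Fin n) : ℝ := dist (q.1 i) (q.1 j) / dist (P.1 i) (P.1 j)
  have scale_comm (i j) : scale i j = scale j i := by
    simp only [scale, dist_comm]
  have scale_eq_of_common {i j l} (hij : i ≠ j) (hil : i ≠ l) : scale i j = scale i l := by
    rcases eq_or_ne j l with rfl | hjl
    · rfl
    have hr := congrFun h ⟨(i, j, l), hij, hjl, hil⟩
    rw [distRatio_apply, distRatio_apply,
      ENNReal.ofReal_eq_ofReal_iff (by positivity) (by positivity),
      div_eq_div_iff (dist_pos_of_ne q hil).ne' (dist_pos_of_ne P hil).ne'] at hr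
    rw [div_eq_div_iff (dist_pos_of_ne P hij).ne' (dist_pos_of_ne P hil).ne', hr, mul_comm]
  have scale_eq {i j} (hij : i ≠ j) : scale i j = scale i₀ j₀ := by
    rcases eq_or_ne i i₀ with rfl | hi
    · exact scale_eq_of_common hij h₀
    · rw [scale_eq_of_common hij hi, scale_comm, scale_eq_of_common hi.symm h₀]
  refine similar_iff_exists_pos_pairwise_dist_eq.2
    ⟨scale i₀ j₀, div_pos (dist_pos_of_ne q h₀) (dist_pos_of_ne P h₀), fun i j hij => ?_⟩
  change _ = scale i₀ j₀ * _
  rw [← scale_eq hij, div_mul_cancel₀ _ (dist_pos_of_ne P hij).ne']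

end Configurations

section Faces

open Topology

variable {n k : ℕ}

theorem ratio_eq_of_mem_compactConfig {x : ConfigAmbient n k} (hx : x ∈ compactConfig n k)
    {t : DistinctTriple n} (h : x.1 t.1.1 ≠ x.1 t.1.2.2) :
    x.2.2 t
      = ENNReal.ofReal (dist (x.1 t.1.1) (x.1 t.1.2.1) / dist (x.1 t.1.1) (x.1 t.1.2.2)) := by
  have : (𝓝[Set.range (configEmbed (n := n) (k := k))] x).NeBot :=
    mem_closure_iff_nhdsWithin_neBot.1 hx
  have hratio : ContinuousAt (fun y : ConfigAmbient n k => y.2.2 t) x := by fun_prop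
  have hdist : ContinuousAt (fun y : ConfigAmbient n k =>
      ENNReal.ofReal (dist (y.1 t.1.1) (y.1 t.1.2.1) / dist (y.1 t.1.1) (y.1 t.1.2.2))) x :=
    ENNReal.continuous_ofReal.continuousAt.comp
      (ContinuousAt.div (by fun_prop) (by fun_prop) (dist_ne_zero.2 h))
  have heq : ∀ᶠ y in 𝓝[Set.range (configEmbed (n := n) (k := k))] x, y.2.2 t
      = ENNReal.ofReal (dist (y.1 t.1.1) (y.1 t.1.2.1) / dist (y.1 t.1.1) (y.1 t.1.2.2)) := by
    filter_upwards [self_mem_nhdsWithin]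
    rintro _ ⟨q, rfl⟩
    exact distRatio_apply q t
  exact tendsto_nhds_unique_of_eventuallyEq hratio.continuousWithinAt hdist.continuousWithinAt heq

theorem eq_of_mem_collisionFace {T : Finset (Fin n)} {x : ConfigAmbient n k}
    (hx : x ∈ collisionFace k T) {i j : Fin n} (hi : i ∈ T) (hj : j ∈ T) : x.1 i = x.1 j := by
  have hclosed : IsClosed {y : ConfigAmbient n k | y.1 i = y.1 j} :=
    isClosed_eq (by fun_prop) (by fun_prop)
  exact closure_minimal (fun y hy => (hy.2.1 i j).2 (Or.inr ⟨hi, hj⟩)) hclosed hx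

theorem ratio_eq_zero_of_mem_collisionFace {T : Finset (Fin n)} {x : ConfigAmbient n k}
    (hx : x ∈ collisionFace k T) {t : DistinctTriple n} (hi : t.1.1 ∈ T) (hj : t.1.2.1 ∈ T)
    (hl : t.1.2.2 ∉ T) : x.2.2 t = 0 := by
  have hclosed : IsClosed {y : ConfigAmbient n k | y.2.2 t = 0} :=
    isClosed_eq (by fun_prop) (by fun_prop)
  refine closure_minimal (fun y hy => ?_) hclosed hx
  have hij : y.1 t.1.1 = y.1 t.1.2.1 := (hy.2.1 _ _).2 (Or.inr ⟨hi, hj⟩)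
  have hil : y.1 t.1.1 ≠ y.1 t.1.2.2 := fun heq =>
    ((hy.2.1 _ _).1 heq).elim t.2.2.2 fun hmem => hl hmem.2
  rw [Set.mem_ofPred_eq, ratio_eq_of_mem_compactConfig hy.1.1 hil, hij, dist_self, zero_div,
    ENNReal.ofReal_zero]

theorem collisionStratum_subset_collisionFaceInterior (S : Finset (Fin n)) :
    collisionStratum k S ⊆ collisionFaceInterior k S := by
  refine fun x hx => ⟨subset_closure hx, fun T hT hTS hxT => ?_⟩
  obtain ⟨i, hi, j, hj, hij⟩ := Finset.one_lt_card.1 hT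
  have mem_S {a b} (ha : a ∈ T) (hb : b ∈ T) (hab : a ≠ b) : a ∈ S :=
    (((hx.2.1 a b).1 (eq_of_mem_collisionFace hxT ha hb)).resolve_left hab).1
  have hT_sub : T ⊆ S := fun a ha => by
    obtain ⟨b, hb, hba⟩ := Finset.exists_mem_ne hT a
    exact mem_S ha hb hba.symm
  obtain ⟨l, hlS, hlT⟩ := Finset.exists_of_ssubset (hT_sub.ssubset_of_ne hTS)
  let t : DistinctTriple n :=
    ⟨(i, j, l), hij, (ne_of_mem_of_not_mem hj hlT), (ne_of_mem_of_not_mem hi hlT)⟩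
  exact (hx.2.2 t (hT_sub hi) (hT_sub hj) hlS).1
    (ratio_eq_zero_of_mem_collisionFace hxT hi hj hlT)

end Faces

section Similarity

open Matrix (toEuclideanCLM orthogonalGroup)

variable {n k : ℕ}

/-- Parameters `(A, s, b)` of the affine map `x ↦ b + s • A x`, a similarity of `ℝ^k` when `0 < s`.
The scale `s` ranges over all of `ℝ` so that the collapse `s = 0` is an interior value. -/
abbrev SimilarityParam (k : ℕ) : Type := orthogonalGroup (Fin k) ℝ × ℝ × EucSpace k

/-- The inclusion of the parameters into the vector space `ℝ^{k×k} × ℝ × ℝ^k`, which defines the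
smooth structure on them. -/
def paramCoord : SimilarityParam k → Matrix (Fin k) (Fin k) ℝ × ℝ × EucSpace k :=
  Prod.map Subtype.val id

theorem isProperMap_paramCoord : IsProperMap (paramCoord (k := k)) :=
  isClosed_unitary.isClosedEmbedding_subtypeVal.isProperMap.prodMap
    (Homeomorph.refl _).isProperMap

theorem paramCoord_injective : Function.Injective (paramCoord (k := k)) :=
  Subtype.val_injective.prodMap Function.injective_id

theorem image_paramCoord :
    paramCoord '' (Set.univ ×ˢ {0} ×ˢ Set.univ) = orthogonalZeroTranslation k := by
  rw [paramCoord, Set.prodMap_image_prod, Set.image_univ, Subtype.range_coe, Set.image_id]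
  rfl

theorem norm_toEuclideanCLM (A : orthogonalGroup (Fin k) ℝ) (v : EucSpace k) :
    ‖toEuclideanCLM (𝕜 := ℝ) A.1 v‖ = ‖v‖ :=
  mem_unitaryGroup_iff_norm_toEuclideanCLM.1 A.2 v

variable (P : OpenConfig n k) (o : Fin n)

/-- The configurations similar to `P`; this is `Sim Δ` when `P` consists of the vertices of `Δ`. -/
def similarConfigs : Set (OpenConfig n k) :=
  {q | ∀ t : DistinctTriple n, distRatio q t = distRatio P t}

/-- What the closure of `similarConfigs P` in the compactified configuration space adds to it; this
is `simBoundary Δ` when `P` consists of the vertices of `Δ`. -/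
def similarBoundary : Set (ConfigAmbient n k) :=
  closure (configEmbed '' similarConfigs P) \ configEmbed '' similarConfigs P

/-- The configuration obtained from `P` by the affine map of parameters `(A, s, b)`, with origin
moved to `P o` so that `P o` is sent to `b`, together with the directions and ratios it has for
every `0 < s`. These do not involve `s`, so at `s = 0` they are the limiting ones. -/
noncomputable def similarityChart (z : SimilarityParam k) : ConfigAmbient n k :=
  (fun i => z.2.2 + z.2.1 • toEuclideanCLM (𝕜 := ℝ) z.1.1 (P.1 i - P.1 o),
    fun p => ⟨toEuclideanCLM (𝕜 := ℝ) z.1.1 (direction P p), by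
      rw [mem_sphere_zero_iff_norm, norm_toEuclideanCLM, norm_eq_of_mem_sphere]⟩,
    distRatio P)

/-- `similarityChart` read in the coordinates `paramCoord` and `ambientCoord`, and extended to
arbitrary matrices. -/
noncomputable def similarityCoordChart (z : Matrix (Fin k) (Fin k) ℝ × ℝ × EucSpace k) :
    (Fin n → EucSpace k) × (DistinctPair n → EucSpace k) × (DistinctTriple n → ℝ) :=
  (fun i => z.2.2 + z.2.1 • toEuclideanCLM (𝕜 := ℝ) z.1 (P.1 i - P.1 o),
    fun p => toEuclideanCLM (𝕜 := ℝ) z.1 (direction P p),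
    fun t => ratioCoord (distRatio P t))

theorem contDiff_similarityCoordChart : ContDiff ℝ ∞ (similarityCoordChart P o) := by
  have := contDiff_toEuclideanCLM (𝕜 := ℝ) (m := Fin k) (r := ∞)
  unfold similarityCoordChart
  fun_prop

theorem continuous_similarityChart : Continuous (similarityChart P o) := by
  have := (contDiff_toEuclideanCLM (𝕜 := ℝ) (m := Fin k) (r := ∞)).continuous
  unfold similarityChart
  fun_prop

variable {P o}

theorem similarityChart_sub (z : SimilarityParam k) (i j : Fin n) :
    (similarityChart P o z).1 i - (similarityChart P o z).1 j
      = z.2.1 • toEuclideanCLM (𝕜 := ℝ) z.1.1 (P.1 i - P.1 j) := by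
  simp only [similarityChart, add_sub_add_left_eq_sub, ← smul_sub, ← map_sub,
    sub_sub_sub_cancel_right]

theorem dist_similarityChart (z : SimilarityParam k) (i j : Fin n) :
    dist ((similarityChart P o z).1 i) ((similarityChart P o z).1 j)
      = |z.2.1| * dist (P.1 i) (P.1 j) := by
  rw [dist_eq_norm, similarityChart_sub, norm_smul, norm_toEuclideanCLM, Real.norm_eq_abs,
    dist_eq_norm]

theorem similarityChart_sub_eq_smul_direction (z : SimilarityParam k) (p : DistinctPair n) :
    (similarityChart P o z).1 p.1.1 - (similarityChart P o z).1 p.1.2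
      = (z.2.1 * dist (P.1 p.1.1) (P.1 p.1.2)) • ((similarityChart P o z).2.1 p : EucSpace k) := by
  rw [similarityChart_sub, ← dist_smul_direction, map_smul, smul_smul]
  rfl

theorem similarityChart_fst_injective {z : SimilarityParam k} (hz : z.2.1 ≠ 0) :
    Function.Injective (similarityChart P o z).1 := fun i j hij => P.2 <| by
  have h := dist_similarityChart (P := P) (o := o) z i j
  rw [hij, dist_self, eq_comm, mul_eq_zero, abs_eq_zero] at h
  exact dist_eq_zero.1 (h.resolve_left hz)

theorem similar_similarityChart {z : SimilarityParam k} (hz : 0 < z.2.1) :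
    Similar (similarityChart P o z).1 P.1 :=
  similar_iff_exists_pos_dist_eq.2 ⟨z.2.1, hz, fun i j => by
    rw [dist_similarityChart, abs_of_pos hz]⟩

theorem configEmbed_eq_similarityChart {q : OpenConfig n k} {z : SimilarityParam k}
    (hz : 0 < z.2.1) (hq : q.1 = (similarityChart P o z).1) :
    configEmbed q = similarityChart P o z := by
  refine Prod.ext hq (Prod.ext (funext fun p => Subtype.ext ?_)
    (distRatio_eq_of_similar (hq ▸ similar_similarityChart hz)))
  refine coe_direction_eq_of_sub_eq_smul (mul_pos hz (dist_pos_of_ne P p.2))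
    (norm_eq_of_mem_sphere _) ?_
  rw [hq, similarityChart_sub_eq_smul_direction]

theorem exists_similarityChart_eq_of_similar {q : OpenConfig n k}
    (hP : affineSpan ℝ (Set.range P.1) = ⊤) (o : Fin n) (hq : Similar q.1 P.1) :
    ∃ z : SimilarityParam k, 0 < z.2.1 ∧ similarityChart P o z = configEmbed q := by
  obtain ⟨s, hs, f, hf⟩ := exists_linearIsometry_of_similar hq hP o
  obtain ⟨A, hA, hAf⟩ := exists_mem_unitaryGroup_toEuclideanCLM_eq f
  refine ⟨(⟨A, hA⟩, s, q.1 o), hs, (configEmbed_eq_similarityChart hs (funext fun i => ?_)).symm⟩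
  change q.1 i = q.1 o + s • toEuclideanCLM (𝕜 := ℝ) A (P.1 i - P.1 o)
  rw [hAf, LinearIsometry.coe_toContinuousLinearMap, ← hf, add_sub_cancel]

theorem image_configEmbed_similarConfigs (hP : affineSpan ℝ (Set.range P.1) = ⊤) (o : Fin n) :
    configEmbed '' similarConfigs P
      = similarityChart P o '' (Set.univ ×ˢ Set.Ioi 0 ×ˢ Set.univ) := by
  apply Set.Subset.antisymm
  · rintro _ ⟨q, hq, rfl⟩
    obtain ⟨z, hz, hzq⟩ :=
      exists_similarityChart_eq_of_similar hP o (similar_of_distRatio_eq (funext hq))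
    exact ⟨z, ⟨trivial, hz, trivial⟩, hzq⟩
  · rintro _ ⟨z, ⟨-, hz, -⟩, rfl⟩
    have hq : configEmbed ⟨_, similarityChart_fst_injective hz.ne'⟩ = similarityChart P o z :=
      configEmbed_eq_similarityChart hz rfl
    exact ⟨_, congrFun (congrArg (fun x => x.2.2) hq), hq⟩

theorem exists_contDiff_leftInverse_similarityChart [Nontrivial (Fin n)]
    (hP : affineSpan ℝ (Set.range P.1) = ⊤) (o : Fin n) :
    ∃ F : (Fin n → EucSpace k) × (DistinctPair n → EucSpace k) × (DistinctTriple n → ℝ) →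
        Matrix (Fin k) (Fin k) ℝ × ℝ × EucSpace k,
      ContDiff ℝ ∞ F ∧ ∀ z, F (ambientCoord (similarityChart P o z)) = paramCoord z := by
  obtain ⟨j, hj⟩ := exists_ne o
  obtain ⟨R, hR⟩ := exists_leftInverse_toEuclideanCLM_apply (span_range_direction hP)
  let p : DistinctPair n := ⟨(j, o), hj⟩
  let scale (y : (Fin n → EucSpace k) × (DistinctPair n → EucSpace k) × (DistinctTriple n → ℝ)) :
      ℝ := inner ℝ (y.1 j - y.1 o) (y.2.1 p) / dist (P.1 j) (P.1 o)
  have hscale : ContDiff ℝ ∞ scale :=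
    (ContDiff.inner ℝ (by fun_prop) (by fun_prop)).div_const _
  refine ⟨fun y => (R y.2.1, scale y, y.1 o), by fun_prop, fun z => ?_⟩
  refine Prod.ext (hR z.1.1) (Prod.ext ?_ ?_)
  · change inner ℝ ((similarityChart P o z).1 j - (similarityChart P o z).1 o)
      ((similarityChart P o z).2.1 p : EucSpace k) / dist (P.1 j) (P.1 o) = z.2.1
    rw [similarityChart_sub_eq_smul_direction z p, real_inner_smul_left,
      real_inner_self_eq_norm_sq, norm_eq_of_mem_sphere, one_pow, mul_one,
      mul_div_cancel_right₀ _ (dist_pos_of_ne P hj).ne']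
  · simp [ambientCoord, similarityChart, paramCoord]

section Boundary

variable [Nontrivial (Fin n)]

theorem similarityChart_injective (hP : affineSpan ℝ (Set.range P.1) = ⊤) (o : Fin n) :
    Function.Injective (similarityChart P o) := by
  obtain ⟨F, -, hF⟩ := exists_contDiff_leftInverse_similarityChart hP o
  exact fun z w hzw => paramCoord_injective (by rw [← hF, ← hF, hzw])

theorem isClosedMap_similarityChart (hP : affineSpan ℝ (Set.range P.1) = ⊤) (o : Fin n) :
    IsClosedMap (similarityChart P o) := by
  obtain ⟨F, hF_smooth, hF⟩ := exists_contDiff_leftInverse_similarityChart hP o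
  have hproper : IsProperMap (F ∘ ambientCoord ∘ similarityChart P o) := by
    rw [show F ∘ ambientCoord ∘ similarityChart P o = paramCoord from funext hF]
    exact isProperMap_paramCoord
  exact (isProperMap_of_comp_of_t2 (continuous_similarityChart P o)
    (hF_smooth.continuous.comp continuous_ambientCoord) hproper).isClosedMap

theorem similarBoundary_eq_image (hP : affineSpan ℝ (Set.range P.1) = ⊤) (o : Fin n) :
    similarBoundary P = similarityChart P o '' (Set.univ ×ˢ {0} ×ˢ Set.univ) := by
  have hparam : closure (Set.univ ×ˢ Set.Ioi 0 ×ˢ Set.univ) \ (Set.univ ×ˢ Set.Ioi 0 ×ˢ Set.univ)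
      = (Set.univ ×ˢ {0} ×ˢ Set.univ : Set (SimilarityParam k)) := by
    ext z
    simp [closure_prod_eq, le_antisymm_iff, and_comm]
  rw [similarBoundary, image_configEmbed_similarConfigs hP o,
    (isClosedMap_similarityChart hP o).closure_image_eq_of_continuous
      (continuous_similarityChart P o), ← Set.image_sdiff (similarityChart_injective hP o), hparam]

theorem similarBoundary_subset_collisionStratum (hP : affineSpan ℝ (Set.range P.1) = ⊤) :
    similarBoundary P ⊆ collisionStratum k Finset.univ := by
  obtain ⟨i, j, hij⟩ := exists_pair_ne (Fin n)
  intro x hx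
  have hx_mem : x ∈ compactConfig n k := closure_mono (Set.image_subset_range _ _) hx.1
  rw [similarBoundary_eq_image hP i] at hx
  obtain ⟨z, ⟨-, hz, -⟩, rfl⟩ := hx
  have hcollapse (a b) : (similarityChart P i z).1 a = (similarityChart P i z).1 b := by
    rw [← dist_eq_zero, dist_similarityChart, Set.mem_singleton_iff.1 hz, abs_zero, zero_mul]
  refine ⟨⟨hx_mem, ?_⟩, fun a b => by simp [hcollapse a b], fun t _ _ _ =>
    ⟨distRatio_ne_zero P t, distRatio_ne_top P t⟩⟩
  rintro ⟨q, hq⟩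
  have hq_fst : (similarityChart P i z).1 = q.1 := congrArg Prod.fst hq.symm
  exact hij (q.2 (hq_fst ▸ hcollapse i j))

theorem areDiffeomorphic_similarBoundary (hP : affineSpan ℝ (Set.range P.1) = ⊤) :
    AreDiffeomorphic (ambientCoord '' similarBoundary P) (orthogonalZeroTranslation k) := by
  obtain ⟨o⟩ : Nonempty (Fin n) := inferInstance
  obtain ⟨F, hF_smooth, hF⟩ := exists_contDiff_leftInverse_similarityChart hP o
  have himage : ambientCoord '' similarBoundary P
      = similarityCoordChart P o '' orthogonalZeroTranslation k := by
    rw [similarBoundary_eq_image hP o, ← image_paramCoord, Set.image_image, Set.image_image]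
    rfl
  rw [himage]
  refine areDiffeomorphic_image (contDiff_similarityCoordChart P o) hF_smooth ?_
  rintro ⟨A, s, b⟩ ⟨hA, -⟩
  exact hF (⟨A, hA⟩, s, b)

end Boundary

end Similarity

theorem mainTheorem5_general {n k : ℕ} [Nontrivial (Fin n)] (P : OpenConfig n k)
    (hP : affineSpan ℝ (Set.range P.1) = ⊤) :
    similarBoundary P ⊆ collisionFaceInterior k (Finset.univ : Finset (Fin n)) ∧
      AreDiffeomorphic (ambientCoord '' similarBoundary P) (orthogonalZeroTranslation k) :=
  ⟨(similarBoundary_subset_collisionStratum hP).trans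
    (collisionStratum_subset_collisionFaceInterior _), areDiffeomorphic_similarBoundary hP⟩

theorem mainTheorem5 (k : ℕ) (hk : 1 ≤ k)
    (Δ : Affine.Simplex ℝ (EuclideanSpace ℝ (Fin k)) k) :
    simBoundary Δ ⊆ collisionFaceInterior k (Finset.univ : Finset (Fin (k + 1))) ∧
      AreDiffeomorphic (ambientCoord '' simBoundary Δ) (orthogonalZeroTranslation k) := by
  have : Nontrivial (Fin (k + 1)) := Fin.nontrivial_iff_two_le.2 (by omega)
  exact mainTheorem5_general (simplexConfig Δ)
    (Δ.independent.affineSpan_eq_top_iff_card_eq_finrank_add_one.2 (by simp))
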